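/- (Jung's Theorem.) Let $\mathfrak{R}=(R,0,1,+,\cdot,<,\dots)$ be an expansion of an ordered field $R$ (which may be non-archimedean), and call a subset of $R^m$ definable if it is definable in $\mathfrak{R}$, possibly with parameters. Suppose that $\mathfrak{R}$ is definably complete, i.e., every non-empty definable subset of $R$ which is bounded from above has a least upper bound in $R$; it is a fact that then every non-negative element $a$ of $R$ has a unique non-negative square root $\sqrt{a}\in R$. For $x=(x_1,\dots,x_n)\in R^n$ put $\|x\|=\sqrt{x_1^2+\cdots+x_n^2}\in R$. Let $n\in\{0,1,2,\dots\}$ and let $A\subseteq R^n$ be a definable set of diameter at most $1$, i.e., $\|a-b\|\le 1$ for all $a,b\in A$. Then $A$ is contained in a closed ball of radius $\varrho=\sqrt{n/(2(n+1))}$: there is $x\in R^n$ with $\|x-a\|\le\varrho$ for all $a\in A$. -/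

import Mathlib

universe u v w

namespace DefinablyComplete

/-! ### Expansions of ordered fields -/

/-- Function symbols `0, 1, +, ·` of the language of ordered fields. -/
inductive OrderedFieldFunc : ℕ → Type
  | zero : OrderedFieldFunc 0
  | one : OrderedFieldFunc 0
  | add : OrderedFieldFunc 2
  | mul : OrderedFieldFunc 2

/-- The relation symbol `<` of the language of ordered fields. -/
inductive OrderedFieldRel : ℕ → Type
  | lt : OrderedFieldRel 2

/-- The first-order language `{0, 1, +, ·, <}` of ordered fields. -/
def orderedField : FirstOrder.Language where
  Functions := OrderedFieldFunc
  Relations := OrderedFieldRel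

/-- Every ordered field is a structure for the language of ordered fields, each symbol having its
usual meaning. -/
instance orderedFieldStructure (R : Type w) [Field R] [LinearOrder R] :
    orderedField.Structure R where
  funMap := fun {_} f => match f with
    | .zero => fun _ => 0
    | .one => fun _ => 1
    | .add => fun x => x 0 + x 1
    | .mul => fun x => x 0 * x 1
  RelMap := fun {_} r => match r with
    | .lt => fun x => x 0 < x 1

/-- `S ⊆ Rⁿ` is definable, with arbitrary parameters from `R`, in the `L`-structure `R`. -/
def IsDefinable (L : FirstOrder.Language.{u, v}) {R : Type w} [L.Structure R] {n : ℕ}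
    (S : Set (Fin n → R)) : Prop :=
  (Set.univ : Set R).Definable L S

/-- The `L`-structure on the ordered set `R` is definably complete: every non-empty subset of `R`
which is definable (with parameters) and bounded from above has a least upper bound in `R`. -/
def IsDefinablyComplete (L : FirstOrder.Language.{u, v}) (R : Type w) [LinearOrder R]
    [L.Structure R] : Prop :=
  ∀ S : Set R, IsDefinable L {x : Fin 1 → R | x 0 ∈ S} → S.Nonempty → BddAbove S →
    ∃ b : R, IsLUB S b

/-! ### The Euclidean norm on `Rⁿ` -/

section Norm

variable {R : Type w} [Field R] [LinearOrder R]

open Classical in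
/-- The non-negative square root of `a` (and `0` if there is none). In a definably complete
expansion of an ordered field every `a ≥ 0` has one, see `sqrt_spec` below. -/
noncomputable def sqrt (a : R) : R :=
  if h : ∃ b : R, 0 ≤ b ∧ b ^ 2 = a then h.choose else 0

/-- The dot product on `Rⁿ`. -/
def dot {n : ℕ} (x y : Fin n → R) : R := ∑ i, x i * y i

/-- The Euclidean norm `‖x‖ = √⟨x, x⟩`, with values in `R`. -/
noncomputable def norm {n : ℕ} (x : Fin n → R) : R := sqrt (dot x x)

/-- The closed ball of radius `r` and centre `x`. -/
def closedBall {n : ℕ} (x : Fin n → R) (r : R) : Set (Fin n → R) :=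
  {y | norm (x - y) ≤ r}

end Norm

/-! ### Square roots exist -/

section Sqrt

variable {L : FirstOrder.Language.{u, v}} {R : Type w} [Field R] [LinearOrder R]
  [L.Structure R]

theorem isDefinable_sq_lt (φ : orderedField →ᴸ L) [φ.IsExpansionOn R] (a : R) :
    IsDefinable L {x : Fin 1 → R | x 0 ∈ {y : R | y * y < a}} := by
  rw [IsDefinable, Set.definable_iff_exists_formula_sum]
  let X : orderedField.Term ((Set.univ : Set R) ⊕ Fin 1) := FirstOrder.Language.Term.var (Sum.inr 0)
  let c : orderedField.Term ((Set.univ : Set R) ⊕ Fin 1) :=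
    FirstOrder.Language.Term.var (Sum.inl ⟨a, trivial⟩)
  let m : orderedField.Functions 2 := OrderedFieldFunc.mul
  let l : orderedField.Relations 2 := OrderedFieldRel.lt
  refine ⟨φ.onFormula (l.formula₂ (m.apply₂ X X) c), ?_⟩
  ext x
  change x 0 * x 0 < a ↔ (φ.onFormula (l.formula₂ (m.apply₂ X X) c)).Realize (Sum.elim Subtype.val x)
  rw [FirstOrder.Language.LHom.realize_onFormula,
    FirstOrder.Language.Formula.realize_rel₂, FirstOrder.Language.Term.realize_functions_apply₂]
  rfl

variable [IsStrictOrderedRing R]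

theorem exists_sqrt (φ : orderedField →ᴸ L) [φ.IsExpansionOn R]
    (hR : IsDefinablyComplete L R) {a : R} (ha : 0 ≤ a) :
    ∃ b : R, 0 ≤ b ∧ b ^ 2 = a := by
  rcases ha.eq_or_lt with rfl | ha
  · exact ⟨0, le_rfl, by simp⟩
  obtain ⟨b, hb⟩ := hR {y : R | y * y < a} (isDefinable_sq_lt φ a) ⟨0, by simpa using ha⟩
    ⟨a + 1, fun y (hy : y * y < a) => by
      by_contra! h
      nlinarith⟩
  have hb0 : 0 ≤ b := hb.1 (show (0 : R) * 0 < a by simpa using ha)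
  refine ⟨b, hb0, ?_⟩
  rcases lt_trichotomy (b ^ 2) a with h | h | h
  · exfalso
    have hpos : 0 < (a - b ^ 2) / (2 * b + 2) := div_pos (by linarith) (by linarith)
    set e := min 1 ((a - b ^ 2) / (2 * b + 2)) with he
    have he0 : 0 < e := lt_min one_pos hpos
    have he1 : e ≤ 1 := min_le_left _ _
    have he2 : e * (2 * b + 2) ≤ a - b ^ 2 :=
      (le_div_iff₀ (by linarith)).1 (min_le_right _ _)
    have : b + e ≤ b := hb.1 (show (b + e) * (b + e) < a by nlinarith)
    linarith
  · exact h
  · exfalso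
    have hbp : 0 < b := by
      rcases hb0.eq_or_lt with rfl | h'
      · simp at h; linarith
      · exact h'
    have he : 2 * b * ((b ^ 2 - a) / (2 * b)) = b ^ 2 - a := by field_simp
    set e := (b ^ 2 - a) / (2 * b)
    have he0 : 0 < e := by
      by_contra! hneg
      nlinarith
    have heb : 0 ≤ b - e := by
      by_contra! hneg
      nlinarith
    have : b ≤ b - e := hb.2 fun y (hy : y * y < a) => by
      by_contra! hlt
      nlinarith
    linarith

theorem sqrt_spec (φ : orderedField →ᴸ L) [φ.IsExpansionOn R]
    (hR : IsDefinablyComplete L R) {a : R} (ha : 0 ≤ a) :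
    0 ≤ sqrt a ∧ sqrt a ^ 2 = a := by
  have h := exists_sqrt φ hR ha
  rw [sqrt, dif_pos h]
  exact h.choose_spec

end Sqrt

end DefinablyComplete

/-!
Jung's theorem by duality. For points `aᵢ` with weights `cᵢ ≥ 0`, `∑ cᵢ = 1`, and centre of mass `p`,
the variance is `∑ cᵢ ‖aᵢ‖² - ‖p‖²`. Let `S` be the supremum of the variances of `n + 1` weighted
points of `A`. It exists, as the set of these variances is definable (`isDefinable_spreads`) and
bounded: if the points have mutual distance at most `1`, the parallel axis theorem
`sum_mul_dot_sub` gives twice the variance at most `1 - ∑ cᵢ² ≤ n / (n + 1)` (`spread_le`). Hence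
`S ≤ n / (2 (n + 1))`, and it remains to find a ball of squared radius `S` containing `A`.

By a Carathéodory argument (`exists_spread_le_of_lt`) `S` also bounds the variances of `n + 2`
points. If the variance of some points is nearly `S`, then adding a further point `b` of `A` with a
small weight cannot raise it by much, which forces `‖b - p‖² ≤ S + ε`: there are approximate centres
(`exists_dot_sub_le`). By the parallel axis theorem any approximate centre is close to the centre of
mass of points of variance nearly `S`, so approximate centres are close to each other
(`sq_sub_le_of_dot_sub_le`). Definable completeness, applied to each coordinate, makes them converge
(`exists_abs_sub_le`), and the limit is the centre sought (`exists_dot_sub_le_of_isLUB`).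

Compactness is not available over `R`; the suprema of definable subsets of `R` above replace it.
Distances are squared throughout, so that the definability of square roots is not needed.
-/

namespace DefinablyComplete

/-! ### Definable functions and definable relations -/

section Definability

variable {L : FirstOrder.Language.{u, v}} {R : Type w} [L.Structure R] {α β : Type*}

theorem definable_not {P : (α → R) → Prop} (h : (Set.univ : Set R).Definable L {v | P v}) :
    (Set.univ : Set R).Definable L {v | ¬ P v} :=
  h.compl

theorem definable_and {P Q : (α → R) → Prop} (hP : (Set.univ : Set R).Definable L {v | P v})
    (hQ : (Set.univ : Set R).Definable L {v | Q v}) :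
    (Set.univ : Set R).Definable L {v | P v ∧ Q v} :=
  hP.inter hQ

theorem definable_imp {P Q : (α → R) → Prop} (hP : (Set.univ : Set R).Definable L {v | P v})
    (hQ : (Set.univ : Set R).Definable L {v | Q v}) :
    (Set.univ : Set R).Definable L {v | P v → Q v} := by
  have := hP.compl.union hQ
  rwa [show {v | P v → Q v} = {v | P v}ᶜ ∪ {v | Q v} by ext v; simp [imp_iff_not_or]]

theorem definable_forall_of_finite {ι : Type*} [Finite ι] {P : ι → (α → R) → Prop}
    (h : ∀ i, (Set.univ : Set R).Definable L {v | P i v}) :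
    (Set.univ : Set R).Definable L {v | ∀ i, P i v} := by
  have := Set.definable_iInter_of_finite h
  rwa [show {v | ∀ i, P i v} = ⋂ i, {v | P i v} by ext v; simp]

/-- Quantification over a tuple of elements of `R` preserves definability. -/
theorem definable_exists [Finite β] {P : (α → R) → (β → R) → Prop}
    (h : (Set.univ : Set R).Definable L
      {v : α ⊕ β → R | P (fun i => v (.inl i)) (fun i => v (.inr i))}) :
    (Set.univ : Set R).Definable L {v | ∃ x, P v x} :=
  h.exists_of_finite

theorem definable_forall [Finite β] {P : (α → R) → (β → R) → Prop}
    (h : (Set.univ : Set R).Definable L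
      {v : α ⊕ β → R | P (fun i => v (.inl i)) (fun i => v (.inr i))}) :
    (Set.univ : Set R).Definable L {v | ∀ x, P v x} :=
  h.forall_of_finite

theorem definableFun_const (a : R) : (Set.univ : Set R).DefinableFun L fun _ : α → R => a :=
  L.definableFun_const α trivial

theorem definableFun_var (i : α) : (Set.univ : Set R).DefinableFun L fun x : α → R => x i :=
  Set.DefinableFun.proj L

variable [Field R] [LinearOrder R]

theorem definableFun_add (φ : orderedField →ᴸ L) [φ.IsExpansionOn R] {f g : (α → R) → R}
    (hf : (Set.univ : Set R).DefinableFun L f) (hg : (Set.univ : Set R).DefinableFun L g) :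
    (Set.univ : Set R).DefinableFun L fun x => f x + g x := by
  let m : orderedField.Functions 2 := OrderedFieldFunc.add
  rw [show (fun x => f x + g x) =
      fun x => FirstOrder.Language.Structure.funMap (φ.onFunction m) ![f x, g x] from
    funext fun x => (φ.map_onFunction m ![f x, g x]).symm]
  exact .comp (g := fun x => ![f x, g x]) (Fin.forall_fin_two.2 ⟨hf, hg⟩)
    (.of_empty (.fun_symbol _))

theorem definableFun_mul (φ : orderedField →ᴸ L) [φ.IsExpansionOn R] {f g : (α → R) → R}
    (hf : (Set.univ : Set R).DefinableFun L f) (hg : (Set.univ : Set R).DefinableFun L g) :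
    (Set.univ : Set R).DefinableFun L fun x => f x * g x := by
  let m : orderedField.Functions 2 := OrderedFieldFunc.mul
  rw [show (fun x => f x * g x) =
      fun x => FirstOrder.Language.Structure.funMap (φ.onFunction m) ![f x, g x] from
    funext fun x => (φ.map_onFunction m ![f x, g x]).symm]
  exact .comp (g := fun x => ![f x, g x]) (Fin.forall_fin_two.2 ⟨hf, hg⟩)
    (.of_empty (.fun_symbol _))

theorem definableFun_sub (φ : orderedField →ᴸ L) [φ.IsExpansionOn R] {f g : (α → R) → R}
    (hf : (Set.univ : Set R).DefinableFun L f) (hg : (Set.univ : Set R).DefinableFun L g) :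
    (Set.univ : Set R).DefinableFun L fun x => f x - g x := by
  -- The language has no symbol for subtraction, but `-1` is a parameter.
  simpa [sub_eq_add_neg] using
    definableFun_add φ hf (definableFun_mul φ (definableFun_const (-1)) hg)

theorem definableFun_sum (φ : orderedField →ᴸ L) [φ.IsExpansionOn R] {ι : Type*} (s : Finset ι)
    {f : ι → (α → R) → R} (hf : ∀ i, (Set.univ : Set R).DefinableFun L (f i)) :
    (Set.univ : Set R).DefinableFun L fun x => ∑ i ∈ s, f i x := by
  classical
  induction s using Finset.induction_on with
  | empty => simpa using definableFun_const 0
  | insert i s hi ih => simpa [Finset.sum_insert hi] using definableFun_add φ (hf i) ih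

theorem definableFun_dot (φ : orderedField →ᴸ L) [φ.IsExpansionOn R] {n : ℕ}
    {f g : (α → R) → Fin n → R} (hf : (Set.univ : Set R).DefinableMap L f)
    (hg : (Set.univ : Set R).DefinableMap L g) :
    (Set.univ : Set R).DefinableFun L fun x => dot (f x) (g x) :=
  definableFun_sum φ _ fun i => definableFun_mul φ (hf i) (hg i)

theorem definable_lt (φ : orderedField →ᴸ L) [φ.IsExpansionOn R] {f g : (α → R) → R}
    (hf : (Set.univ : Set R).DefinableFun L f) (hg : (Set.univ : Set R).DefinableFun L g) :
    (Set.univ : Set R).Definable L {x | f x < g x} := by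
  let l : orderedField.Relations 2 := OrderedFieldRel.lt
  have h : (Set.univ : Set R).Definable L {x : Fin 2 → R | x 0 < x 1} := by
    refine .mono ?_ (Set.empty_subset _)
    rw [Set.empty_definable_iff]
    refine ⟨φ.onFormula (l.formula₂ (FirstOrder.Language.Term.var 0)
      (FirstOrder.Language.Term.var 1)), ?_⟩
    ext x
    change x 0 < x 1 ↔ (φ.onFormula _).Realize x
    rw [FirstOrder.Language.LHom.realize_onFormula, FirstOrder.Language.Formula.realize_rel₂]
    rfl
  exact h.preimage_map (F := fun x => ![f x, g x]) (Fin.forall_fin_two.2 ⟨hf, hg⟩)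

theorem definable_le (φ : orderedField →ᴸ L) [φ.IsExpansionOn R] {f g : (α → R) → R}
    (hf : (Set.univ : Set R).DefinableFun L f) (hg : (Set.univ : Set R).DefinableFun L g) :
    (Set.univ : Set R).Definable L {x | f x ≤ g x} := by
  simpa using definable_not (definable_lt φ hg hf)

end Definability

/-! ### Weighted families of points -/

section Spread

variable {R : Type w} [Field R] {ι : Type*} [Fintype ι] {n : ℕ}

/-- The centre of mass of the points `a i` with weights `c i`. -/
def mean (c : ι → R) (a : ι → Fin n → R) : Fin n → R := ∑ i, c i • a i

/-- The variance `∑ cᵢ ‖aᵢ‖² - ‖∑ cᵢ aᵢ‖²` of the points `a i` with weights `c i`;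
the name is apt for weights of sum `1`. -/
def spread (c : ι → R) (a : ι → Fin n → R) : R :=
  ∑ i, c i * dot (a i) (a i) - dot (mean c a) (mean c a)

/-- The parallel axis theorem. -/
theorem sum_mul_dot_sub (c : ι → R) (a : ι → Fin n → R) (hc : ∑ i, c i = 1) (x : Fin n → R) :
    ∑ i, c i * dot (x - a i) (x - a i) = spread c a + dot (x - mean c a) (x - mean c a) := by
  have h1 : dot x (mean c a) = ∑ i, c i * dot x (a i) := by
    change x ⬝ᵥ ∑ i, c i • a i = ∑ i, c i * (x ⬝ᵥ a i)
    simp [dotProduct_sum]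
  have h (y : Fin n → R) : dot (x - y) (x - y) = dot x x - 2 * dot x y + dot y y := by
    change (x - y) ⬝ᵥ (x - y) = x ⬝ᵥ x - 2 * (x ⬝ᵥ y) + y ⬝ᵥ y
    rw [sub_dotProduct, dotProduct_sub, dotProduct_sub, dotProduct_comm y x]
    ring
  simp only [h, mul_add, mul_sub, Finset.sum_add_distrib, Finset.sum_sub_distrib, spread, h1,
    ← Finset.sum_mul, hc, mul_left_comm _ (2 : R), ← Finset.mul_sum]
  ring

theorem spread_cons {k : ℕ} (c : Fin k → R) (a : Fin k → Fin n → R) (b : Fin n → R) (t : R) :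
    spread (Fin.cons t ((1 - t) • c) : Fin (k + 1) → R) (Fin.cons b a : Fin (k + 1) → Fin n → R) =
      (1 - t) * spread c a + t * (1 - t) * dot (b - mean c a) (b - mean c a) := by
  have hm : mean (Fin.cons t ((1 - t) • c) : Fin (k + 1) → R)
      (Fin.cons b a : Fin (k + 1) → Fin n → R) = t • b + (1 - t) • mean c a := by
    simp [mean, Fin.sum_univ_succ, Finset.smul_sum, mul_smul]
  have hd (x y : Fin n → R) : dot (t • x + (1 - t) • y) (t • x + (1 - t) • y) =
      t * dot x x + (1 - t) * dot y y - t * (1 - t) * dot (x - y) (x - y) := by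
    simp only [dot, Finset.mul_sum, ← Finset.sum_add_distrib, ← Finset.sum_sub_distrib]
    refine Finset.sum_congr rfl fun i _ => ?_
    simp only [Pi.add_apply, Pi.smul_apply, Pi.sub_apply, smul_eq_mul]
    ring
  rw [spread, hm, hd, spread]
  simp only [Fin.sum_univ_succ, Fin.cons_zero, Fin.cons_succ, Pi.smul_apply, smul_eq_mul,
    mul_assoc, ← Finset.mul_sum]
  ring

variable [LinearOrder R] [IsStrictOrderedRing R]

theorem dot_self_nonneg (x : Fin n → R) : 0 ≤ dot x x :=
  Finset.sum_nonneg fun i _ => mul_self_nonneg (x i)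

/-- Points at mutual distance at most `1` have small variance: summing the parallel axis theorem
at the points `a j` themselves yields twice the variance. -/
theorem two_mul_spread_le {c : ι → R} {a : ι → Fin n → R} (hc0 : ∀ i, 0 ≤ c i)
    (hc : ∑ i, c i = 1) (ha : ∀ i j, dot (a i - a j) (a i - a j) ≤ 1) :
    2 * spread c a ≤ 1 - ∑ i, c i ^ 2 := by
  classical
  have h1 (j : ι) : spread c a + dot (a j - mean c a) (a j - mean c a) ≤ 1 - c j := by
    rw [← sum_mul_dot_sub c a hc, ← hc, ← Finset.sum_erase_add _ _ (Finset.mem_univ j),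
      ← Finset.sum_erase_add _ c (Finset.mem_univ j)]
    have : dot (a j - a j) (a j - a j) = 0 := by simp [dot]
    rw [this, mul_zero, add_zero, add_sub_cancel_right]
    exact Finset.sum_le_sum fun i _ => mul_le_of_le_one_right (hc0 i) (ha j i)
  have h2 : ∑ j, c j * (spread c a + dot (a j - mean c a) (a j - mean c a)) ≤
      ∑ j, c j * (1 - c j) :=
    Finset.sum_le_sum fun j _ => mul_le_mul_of_nonneg_left (h1 j) (hc0 j)
  have h3 : ∑ j, c j * dot (a j - mean c a) (a j - mean c a) = spread c a := by
    have h := sum_mul_dot_sub c a hc (mean c a)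
    have h0 : dot (mean c a - mean c a) (mean c a - mean c a) = 0 := by simp [dot]
    rw [h0, add_zero] at h
    rw [← h]
    exact Finset.sum_congr rfl fun j _ => by simp only [dot, Pi.sub_apply]; congr 2; ext; ring
  simp only [mul_add, mul_sub, mul_one, Finset.sum_add_distrib, Finset.sum_sub_distrib, h3,
    ← Finset.sum_mul, hc, one_mul, ← pow_two] at h2
  linarith

theorem spread_le {c : Fin (n + 1) → R} {a : Fin (n + 1) → Fin n → R} (hc0 : ∀ i, 0 ≤ c i)
    (hc : ∑ i, c i = 1) (ha : ∀ i j, dot (a i - a j) (a i - a j) ≤ 1) :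
    spread c a ≤ n / (2 * (n + 1)) := by
  have h1 := two_mul_spread_le hc0 hc ha
  have h2 := sq_sum_le_card_mul_sum_sq (s := Finset.univ) (f := c)
  rw [hc, Finset.card_univ, Fintype.card_fin] at h2
  push_cast at h2
  have hn : (0 : R) < n + 1 := by positivity
  rw [le_div_iff₀ (by positivity)]
  nlinarith

/-- Carathéodory reduction: of more than `n + 1` weighted points of `Rⁿ` one can be dropped without
decreasing the variance. Moving the weights along an affine dependence of the points changes neither
the total weight nor the centre of mass; the sign of the dependence is chosen such that
`∑ cᵢ ‖aᵢ‖²` does not decrease, and the motion stops when a weight vanishes. -/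
theorem exists_spread_le_of_lt {k : ℕ} (hk : n + 1 < k + 1) {c : Fin (k + 1) → R}
    {a : Fin (k + 1) → Fin n → R} (hc0 : ∀ i, 0 ≤ c i) (hc : ∑ i, c i = 1) :
    ∃ (c' : Fin k → R) (a' : Fin k → Fin n → R), (∀ i, 0 ≤ c' i) ∧ ∑ i, c' i = 1 ∧
      (∀ i, a' i ∈ Set.range a) ∧ spread c a ≤ spread c' a' := by
  have hdep : ∃ g : Fin (k + 1) → R, g ≠ 0 ∧ ∑ i, g i = 0 ∧ ∑ i, g i • a i = 0 := by
    have hker := LinearMap.ker_ne_bot_of_finrank_lt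
      (f := Fintype.linearCombination R fun i => ((1 : R), a i)) (by simpa [add_comm] using hk)
    obtain ⟨g, hg, hg0⟩ := Submodule.exists_mem_ne_zero_of_ne_bot hker
    rw [LinearMap.mem_ker, Fintype.linearCombination_apply, Prod.ext_iff] at hg
    exact ⟨g, hg0, by simpa [Prod.fst_sum] using hg.1, by simpa [Prod.snd_sum] using hg.2⟩
  obtain ⟨g, hg0, hgs, hga, hgd⟩ : ∃ g : Fin (k + 1) → R, g ≠ 0 ∧ ∑ i, g i = 0 ∧
      ∑ i, g i • a i = 0 ∧ 0 ≤ ∑ i, g i * dot (a i) (a i) := by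
    obtain ⟨g, h0, h1, h2⟩ := hdep
    rcases le_total 0 (∑ i, g i * dot (a i) (a i)) with h | h
    · exact ⟨g, h0, h1, h2, h⟩
    · exact ⟨-g, neg_ne_zero.2 h0, by simp [h1], by simp [h2], by simpa using h⟩
  obtain ⟨j, hj⟩ : ∃ j, g j < 0 := by
    by_contra! h
    exact hg0 (funext fun i => (Finset.sum_eq_zero_iff_of_nonneg fun i _ => h i).1 hgs i
      (Finset.mem_univ i))
  obtain ⟨m, hm, hmin⟩ := Finset.exists_min_image (Finset.univ.filter fun i => g i < 0)
    (fun i => c i / -g i) ⟨j, by simpa using hj⟩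
  simp only [Finset.mem_filter, Finset.mem_univ, true_and] at hm hmin
  set t := c m / -g m with ht
  have ht0 : 0 ≤ t := div_nonneg (hc0 m) (by linarith)
  have hm0 : c m + t * g m = 0 := by
    rw [ht, div_neg, neg_mul, div_mul_cancel₀ _ hm.ne, add_neg_cancel]
  have hnn (i) : 0 ≤ c i + t * g i := by
    rcases lt_or_ge (g i) 0 with h | h
    · have := (le_div_iff₀ (neg_pos.2 h)).1 (hmin i h)
      linarith
    · exact add_nonneg (hc0 i) (mul_nonneg ht0 h)
  have hmean : ∑ i, (c i + t * g i) • a i = mean c a := by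
    simp only [add_smul, Finset.sum_add_distrib, mul_smul, ← Finset.smul_sum, hga, smul_zero,
      add_zero, mean]
  have hsq : ∑ i, (c i + t * g i) * dot (a i) (a i) =
      ∑ i, c i * dot (a i) (a i) + t * ∑ i, g i * dot (a i) (a i) := by
    simp only [add_mul, Finset.sum_add_distrib, mul_assoc, Finset.mul_sum]
  have hsum : ∑ i, (c i + t * g i) = 1 := by
    simp only [Finset.sum_add_distrib, ← Finset.mul_sum, hgs, hc, mul_zero, add_zero]
  rw [Fin.sum_univ_succAbove _ m, hm0] at hmean hsq hsum
  simp only [zero_smul, zero_mul, zero_add] at hmean hsq hsum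
  refine ⟨fun i => c (m.succAbove i) + t * g (m.succAbove i), fun i => a (m.succAbove i),
    fun i => hnn _, hsum, fun i => ⟨_, rfl⟩, ?_⟩
  change _ ≤ _ - dot (∑ i, _) (∑ i, _)
  rw [hmean, hsq, spread]
  linarith [mul_nonneg ht0 hgd]

end Spread

/-! ### The maximal variance of points of a set -/

section Jung

variable {L : FirstOrder.Language.{u, v}} {R : Type w} [L.Structure R] [Field R] [LinearOrder R]
  {n : ℕ} {A : Set (Fin n → R)}

/-- The variances of `n + 1` weighted points of `A ⊆ Rⁿ`, the weights being non-negative with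
sum `1`. -/
def spreads (A : Set (Fin n → R)) : Set R :=
  {x | ∃ (c : Fin (n + 1) → R) (a : Fin (n + 1) → Fin n → R), (∀ i, 0 ≤ c i) ∧ ∑ i, c i = 1 ∧
    (∀ i, a i ∈ A) ∧ x = spread c a}

theorem isDefinable_spreads (φ : orderedField →ᴸ L) [φ.IsExpansionOn R] (hA : IsDefinable L A) :
    IsDefinable L {x : Fin 1 → R | x 0 ∈ spreads A} := by
  have h : {x : Fin 1 → R | x 0 ∈ spreads A} =
      {x | ∃ c : Fin (n + 1) → R, ∃ a : Fin (n + 1) × Fin n → R, (∀ i, 0 ≤ c i) ∧ ∑ i, c i = 1 ∧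
        (∀ i, (fun k => a (i, k)) ∈ A) ∧ x 0 = spread c fun i k => a (i, k)} := by
    ext x
    constructor
    · rintro ⟨c, a, h⟩
      exact ⟨c, fun p => a p.1 p.2, h⟩
    · rintro ⟨c, a, h⟩
      exact ⟨c, fun i k => a (i, k), h⟩
  rw [h]
  refine definable_exists (definable_exists
    (definable_and ?_ (definable_and ?_ (definable_and ?_ ?_))))
  · exact definable_forall_of_finite fun i =>
      definable_le φ (definableFun_const 0) (definableFun_var _)
  · exact Set.DefinableFun.ofPred_eq (definableFun_sum φ _ fun i => definableFun_var _)
      (definableFun_const 1)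
  · exact definable_forall_of_finite fun i => hA.preimage_comp fun k => Sum.inr (i, k)
  · have hmean (k : Fin n) : (Set.univ : Set R).DefinableFun L
        fun v : (Fin 1 ⊕ Fin (n + 1)) ⊕ (Fin (n + 1) × Fin n) → R =>
          mean (fun i => v (.inl (.inr i))) (fun i k => v (.inr (i, k))) k := by
      simp only [mean, Finset.sum_apply, Pi.smul_apply, smul_eq_mul]
      exact definableFun_sum φ _ fun i =>
        definableFun_mul φ (definableFun_var _) (definableFun_var _)
    exact Set.DefinableFun.ofPred_eq (definableFun_var _)
      (definableFun_sub φ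
        (definableFun_sum φ _ fun i => definableFun_mul φ (definableFun_var _)
          (definableFun_dot φ (fun _ => definableFun_var _) (fun _ => definableFun_var _)))
        (definableFun_dot φ hmean hmean))

variable [IsStrictOrderedRing R]

theorem mem_upperBounds_spreads (hA : ∀ a ∈ A, ∀ b ∈ A, dot (a - b) (a - b) ≤ 1) :
    (n : R) / (2 * (n + 1)) ∈ upperBounds (spreads A) := by
  rintro _ ⟨c, a, hc0, hc, ha, rfl⟩
  exact spread_le hc0 hc fun i j => hA _ (ha i) _ (ha j)

theorem spreads_nonempty (hA : A.Nonempty) : (spreads A).Nonempty := by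
  obtain ⟨b, hb⟩ := hA
  exact ⟨_, fun i => if i = 0 then 1 else 0, fun _ => b,
    fun i => by dsimp only; split_ifs <;> simp, by simp, fun _ => hb, rfl⟩

/-- A bound for the variances of `n + 1` points of `A` is also one for the `n + 2` points obtained
by adding a point `b` of `A`, of weight `t`. -/
theorem spread_add_le {S : R} (hS : S ∈ upperBounds (spreads A)) {c : Fin (n + 1) → R}
    {a : Fin (n + 1) → Fin n → R} (hc0 : ∀ i, 0 ≤ c i) (hc : ∑ i, c i = 1) (ha : ∀ i, a i ∈ A)
    {b : Fin n → R} (hb : b ∈ A) {t : R} (ht0 : 0 ≤ t) (ht1 : t ≤ 1) :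
    (1 - t) * spread c a + t * (1 - t) * dot (b - mean c a) (b - mean c a) ≤ S := by
  rw [← spread_cons c a]
  obtain ⟨c', a', hc0', hc', ha', h⟩ := exists_spread_le_of_lt (Nat.lt_succ_self (n + 1))
    (c := Fin.cons t ((1 - t) • c)) (a := Fin.cons b a)
    (Fin.cases ht0 fun i => by simpa using mul_nonneg (sub_nonneg.2 ht1) (hc0 i))
    (by simp [Fin.sum_univ_succ (n := n + 1), ← Finset.mul_sum, hc])
  refine h.trans (hS ⟨c', a', hc0', hc', fun i => ?_, rfl⟩)
  obtain ⟨j, hj⟩ := ha' i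
  rw [← hj]
  exact Fin.cases (motive := fun j => (Fin.cons b a : Fin (n + 2) → Fin n → R) j ∈ A) hb ha j

/-- The centre of mass of points whose variance is nearly maximal is nearly the centre of a ball
containing `A` and of squared radius the maximal variance: otherwise giving a small weight `t` to a
point of `A` far from it would increase the variance too much. -/
theorem exists_dot_sub_le {S : R} (hS : IsLUB (spreads A) S) (hS1 : S ≤ 1)
    {ε : R} (hε0 : 0 < ε) (hε1 : ε ≤ 1) :
    ∃ y : Fin n → R, ∀ b ∈ A, dot (b - y) (b - y) ≤ S + ε := by
  obtain ⟨_, ⟨c, a, hc0, hc, ha, rfl⟩, hlt, -⟩ :=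
    hS.exists_between (b := S - ε ^ 2 / 20) (by have := pow_pos hε0 2; linarith)
  refine ⟨mean c a, fun b hb => ?_⟩
  have hV : spread c a ≤ S := hS.1 ⟨c, a, hc0, hc, ha, rfl⟩
  set D := dot (b - mean c a) (b - mean c a)
  have hε2 : ε ^ 2 ≤ 1 := pow_le_one₀ hε0.le hε1
  have hD0 : 0 ≤ D := dot_self_nonneg _
  -- The weight `1 / 2` gives a crude bound for `D`, the weight `ε / 10` then the sharp one.
  have hD : D ≤ 4 := by
    have := spread_add_le hS.1 hc0 hc ha hb (t := 1 / 2) (by norm_num) (by norm_num)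
    linarith
  have h := spread_add_le hS.1 hc0 hc ha hb (t := ε / 10) (by linarith) (by linarith)
  have h1 : (1 - ε / 10) * (S - ε ^ 2 / 20) ≤ (1 - ε / 10) * spread c a :=
    mul_le_mul_of_nonneg_left hlt.le (by linarith)
  have h2 : (ε / 10) * (ε / 10) * D ≤ (ε / 10) * (ε / 10) * 4 :=
    mul_le_mul_of_nonneg_left hD (by positivity)
  have h3 : 0 < ε ^ 3 := pow_pos hε0 3
  refine le_of_mul_le_mul_left (a := ε / 10) ?_ (by linarith)
  have h4 : 0 < ε ^ 2 := pow_pos hε0 2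
  change (1 - ε / 10) * spread c a + ε / 10 * (1 - ε / 10) * D ≤ S at h
  linarith

/-- Two approximate centres are close to each other, since by the parallel axis theorem both are
close to the centre of mass of any points of nearly maximal variance. -/
theorem sq_sub_le_of_dot_sub_le {S : R} (hS : IsLUB (spreads A) S) {ε : R}
    {y z : Fin n → R} (hy : ∀ b ∈ A, dot (b - y) (b - y) ≤ S + ε)
    (hz : ∀ b ∈ A, dot (b - z) (b - z) ≤ S + ε) (i : Fin n) : (y i - z i) ^ 2 ≤ 4 * ε := by
  refine le_of_forall_pos_le_add fun η hη => ?_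
  obtain ⟨_, ⟨c, a, hc0, hc, ha, rfl⟩, hlt, -⟩ :=
    hS.exists_between (b := S - η / 4) (by linarith)
  have key (x : Fin n → R) (hx : ∀ b ∈ A, dot (b - x) (b - x) ≤ S + ε) :
      (x i - mean c a i) ^ 2 ≤ ε + η / 4 := by
    have h1 := sum_mul_dot_sub c a hc x
    have h2 : ∑ j, c j * dot (x - a j) (x - a j) ≤ ∑ j, c j * (S + ε) :=
      Finset.sum_le_sum fun j _ => mul_le_mul_of_nonneg_left
        ((le_of_eq (by simp only [dot, Pi.sub_apply]; congr 1; ext; ring)).trans (hx _ (ha j)))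
        (hc0 j)
    have h3 : (x i - mean c a i) * (x i - mean c a i) ≤ dot (x - mean c a) (x - mean c a) :=
      Finset.single_le_sum (f := fun k => (x - mean c a) k * (x - mean c a) k)
        (fun k _ => mul_self_nonneg _) (Finset.mem_univ i)
    rw [← Finset.sum_mul, hc, one_mul] at h2
    linarith
  have := key y hy
  have := key z hz
  linarith [sq_nonneg ((y i - mean c a i) + (z i - mean c a i))]

/-! ### The centre -/

/-- Approximate centres converge: there is a point to which all of them are close. Its coordinates
are least upper bounds of definable sets. -/
theorem exists_abs_sub_le (φ : orderedField →ᴸ L) [φ.IsExpansionOn R]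
    (hR : IsDefinablyComplete L R) (hA : IsDefinable L A) {S : R} (hS : IsLUB (spreads A) S)
    (hS1 : S ≤ 1) :
    ∃ x : Fin n → R, ∀ s, 0 < s → ∀ y : Fin n → R, (∀ b ∈ A, dot (b - y) (b - y) ≤ S + s * s) →
      ∀ i, |x i - y i| ≤ 2 * s := by
  have hex (s : R) (hs : 0 < s) : ∃ y : Fin n → R, ∀ b ∈ A, dot (b - y) (b - y) ≤ S + s * s := by
    obtain ⟨y, hy⟩ := exists_dot_sub_le hS hS1 (ε := min (s * s) 1)
      (lt_min (mul_pos hs hs) one_pos) (min_le_right _ _)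
    exact ⟨y, fun b hb => (hy b hb).trans (by gcongr; exact min_le_left _ _)⟩
  have hclose (s : R) (hs : 0 < s) (y z : Fin n → R)
      (hy : ∀ b ∈ A, dot (b - y) (b - y) ≤ S + s * s)
      (hz : ∀ b ∈ A, dot (b - z) (b - z) ≤ S + s * s) (i : Fin n) : |y i - z i| ≤ 2 * s :=
    abs_le_of_sq_le_sq ((sq_sub_le_of_dot_sub_le hS hy hz i).trans_eq (by ring)) (by linarith)
  -- The `i`-th coordinate of the centre is the limit inferior of the `i`-th coordinates of the
  -- approximate centres.
  let T (i : Fin n) : Set R := {t | ∃ s, 0 < s ∧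
    ∀ y : Fin n → R, (∀ b ∈ A, dot (b - y) (b - y) ≤ S + s * s) → t ≤ y i}
  have hdef (i : Fin n) : IsDefinable L {x : Fin 1 → R | x 0 ∈ T i} := by
    have h : {x : Fin 1 → R | x 0 ∈ T i} = {x | ∃ s : Fin 1 → R, 0 < s 0 ∧ ∀ y : Fin n → R,
        (∀ b : Fin n → R, b ∈ A → dot (b - y) (b - y) ≤ S + s 0 * s 0) → x 0 ≤ y i} := by
      ext x
      constructor
      · rintro ⟨s, h⟩
        exact ⟨fun _ => s, h⟩
      · rintro ⟨s, h⟩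
        exact ⟨s 0, h⟩
    rw [h]
    refine definable_exists (definable_and ?_ (definable_forall
      (definable_imp (definable_forall (definable_imp ?_ ?_)) ?_)))
    · exact definable_lt φ (definableFun_const 0) (definableFun_var _)
    · exact hA.preimage_comp Sum.inr
    · exact definable_le φ
        (definableFun_dot φ
          (fun _ => definableFun_sub φ (definableFun_var _) (definableFun_var _))
          (fun _ => definableFun_sub φ (definableFun_var _) (definableFun_var _)))
        (definableFun_add φ (definableFun_const S)
          (definableFun_mul φ (definableFun_var _) (definableFun_var _)))
    · exact definable_le φ (definableFun_var _) (definableFun_var _)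
  have hmem (s : R) (hs : 0 < s) (y : Fin n → R)
      (hy : ∀ b ∈ A, dot (b - y) (b - y) ≤ S + s * s) (i : Fin n) : y i - 2 * s ∈ T i :=
    ⟨s, hs, fun z hz => by linarith [(abs_le.1 (hclose s hs y z hy hz i)).2]⟩
  have hle (s : R) (hs : 0 < s) (y : Fin n → R)
      (hy : ∀ b ∈ A, dot (b - y) (b - y) ≤ S + s * s) (i : Fin n) :
      y i + 2 * s ∈ upperBounds (T i) := by
    rintro t ⟨r, hr, ht⟩
    have hm : 0 < min r s := lt_min hr hs
    obtain ⟨z, hz⟩ := hex (min r s) hm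
    have h1 := ht z fun b hb => (hz b hb).trans (by gcongr <;> exact min_le_left _ _)
    have h2 := hclose s hs y z hy
      (fun b hb => (hz b hb).trans (by gcongr <;> exact min_le_right _ _)) i
    linarith [(abs_le.1 h2).1]
  obtain ⟨y₁, hy₁⟩ := hex 1 one_pos
  choose x hx using fun i => hR (T i) (hdef i) ⟨_, hmem 1 one_pos y₁ hy₁ i⟩
    ⟨_, hle 1 one_pos y₁ hy₁ i⟩
  refine ⟨x, fun s hs y hy i => abs_le.2 ⟨?_, ?_⟩⟩
  · linarith [(hx i).1 (hmem s hs y hy i)]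
  · linarith [(hx i).2 (hle s hs y hy i)]

/-- The supremum of the variances is the squared radius of a ball containing `A`. -/
theorem exists_dot_sub_le_of_isLUB (φ : orderedField →ᴸ L) [φ.IsExpansionOn R]
    (hR : IsDefinablyComplete L R) (hA : IsDefinable L A) {S : R} (hS : IsLUB (spreads A) S)
    (hS1 : S ≤ 1) :
    ∃ x : Fin n → R, ∀ b ∈ A, dot (x - b) (x - b) ≤ S := by
  obtain ⟨x, hx⟩ := exists_abs_sub_le φ hR hA hS hS1
  refine ⟨x, fun b hb => le_of_forall_pos_le_add fun ε hε => ?_⟩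
  have hn : (0 : R) < 1 + n * 12 := by positivity
  set s := min 1 (ε / (1 + n * 12)) with hs
  have hs0 : 0 < s := lt_min one_pos (div_pos hε hn)
  have hs1 : s ≤ 1 := min_le_left _ _
  have hsε : s * (1 + n * 12) ≤ ε := (le_div_iff₀ hn).1 (min_le_right _ _)
  have hss : s * s ≤ s := mul_le_of_le_one_left hs0.le hs1
  obtain ⟨y, hy⟩ := exists_dot_sub_le hS hS1 (mul_pos hs0 hs0) (hss.trans hs1)
  have hby := hy b hb
  have hterm (i : Fin n) :
      (x - b) i * (x - b) i ≤ (b - y) i * (b - y) i + 12 * s := by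
    have h1 : (b - y) i * (b - y) i ≤ dot (b - y) (b - y) :=
      Finset.single_le_sum (f := fun k => (b - y) k * (b - y) k)
        (fun k _ => mul_self_nonneg _) (Finset.mem_univ i)
    have h2 : |(b - y) i| ≤ 2 := abs_le_of_sq_le_sq (by linarith) (by norm_num)
    have h3 := hx s hs0 y hy i
    have h4 : |(b - y) i * (x i - y i)| ≤ 2 * (2 * s) := by
      rw [abs_mul]
      exact mul_le_mul h2 h3 (abs_nonneg _) (by norm_num)
    have h5 : (x i - y i) * (x i - y i) ≤ 2 * s * (2 * s) := by
      rw [← abs_mul_abs_self]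
      exact mul_self_le_mul_self (abs_nonneg _) h3
    have h6 := neg_le_of_abs_le h4
    simp only [Pi.sub_apply] at *
    linarith
  calc dot (x - b) (x - b) ≤ ∑ i, ((b - y) i * (b - y) i + 12 * s) :=
        Finset.sum_le_sum fun i _ => hterm i
    _ = dot (b - y) (b - y) + n * (12 * s) := by simp [Finset.sum_add_distrib, dot]
    _ ≤ S + ε := by linarith

theorem dot_self_le_one (φ : orderedField →ᴸ L) [φ.IsExpansionOn R]
    (hR : IsDefinablyComplete L R) {x : Fin n → R} (hx : norm x ≤ 1) : dot x x ≤ 1 := by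
  obtain ⟨h0, h⟩ := sqrt_spec φ hR (dot_self_nonneg x)
  rw [← h]
  exact pow_le_one₀ h0 hx

theorem sqrt_le_sqrt (φ : orderedField →ᴸ L) [φ.IsExpansionOn R]
    (hR : IsDefinablyComplete L R) {a b : R} (ha : 0 ≤ a) (hab : a ≤ b) : sqrt a ≤ sqrt b := by
  obtain ⟨-, h1⟩ := sqrt_spec φ hR ha
  obtain ⟨h0, h2⟩ := sqrt_spec φ hR (ha.trans hab)
  exact le_of_sq_le_sq (by rw [h1, h2]; exact hab) h0

end Jung

end DefinablyComplete

theorem mainTheorem8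
    {R : Type w} [Field R] [LinearOrder R] [IsStrictOrderedRing R]
    {L : FirstOrder.Language.{u, v}} [L.Structure R]
    (φ : DefinablyComplete.orderedField →ᴸ L) [φ.IsExpansionOn R]
    (hR : DefinablyComplete.IsDefinablyComplete L R)
    (n : ℕ) (A : Set (Fin n → R)) (hA : DefinablyComplete.IsDefinable L A)
    (hdiam : ∀ a ∈ A, ∀ b ∈ A, DefinablyComplete.norm (a - b) ≤ 1) :
    ∃ x : Fin n → R,
      A ⊆ DefinablyComplete.closedBall x
        (DefinablyComplete.sqrt ((n : R) / (2 * ((n : R) + 1)))) := by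
  open DefinablyComplete in
  rcases A.eq_empty_or_nonempty with rfl | hne
  · exact ⟨0, Set.empty_subset _⟩
  have hub := mem_upperBounds_spreads fun a ha b hb => dot_self_le_one φ hR (hdiam a ha b hb)
  obtain ⟨S, hS⟩ := hR _ (isDefinable_spreads φ hA) (spreads_nonempty hne) ⟨_, hub⟩
  have hSn := hS.2 hub
  have hn : (0 : R) ≤ n := n.cast_nonneg
  have hS1 : S ≤ 1 := hSn.trans ((div_le_one₀ (by linarith)).2 (by linarith))
  obtain ⟨x, hx⟩ := exists_dot_sub_le_of_isLUB φ hR hA hS hS1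
  exact ⟨x, fun b hb => sqrt_le_sqrt φ hR (dot_self_nonneg _) ((hx b hb).trans hSn)⟩
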